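/- Setting. Let $b:[0,1]\to\mathbb R$ be a bid function (bid as a function of the quantile) that is twice continuously differentiable with $b'>0$ on $[0,1]$. A bid is $b(U)$ with $U$ uniform on $[0,1]$; on its support $b([0,1])$ it has c.d.f. $G=b^{-1}$ and density $g(z)=\frac{d}{dz}b^{-1}(z)$, so $g(b(q))=1/b'(q)$. From $N$ independent bids, sorted as $s_{(1)}\le\dots\le s_{(N)}$, define the estimated bid function $\hat b(q)=s_{(i)}$ for $q\in[i-1,i)/N$. Let $\hat g=\hat g_N$ be an estimator of $g$ (a jointly measurable function of the sample and of the point), and define the estimator of the derivative of the bid function by $$\hat b'(q)=\frac1{\hat g(\hat b(q))}.$$ Assumptions. Let $0<c$ and $\bar g$, $K$, $L$ be constants with $c<g\le\bar g$ on $b([0,1])$, and suppose that $\hat g$ has the rate of convergence $r=r_N$: $r_N\to\infty$, $r_N=O(\sqrt N)$, and $$E\Big[\sup_{z\in b([0,1])}|\hat g_N(z)-g(z)|^2\Big]^{1/2}\le \frac{K}{r_N}\quad\text{for all large }N.$$ Theorem. There is a constant $C>0$, depending only on $K,c,\bar g,L$, such that in every such setting the following hold. (1) $\sup_{q\in[0,1)}P\big(\hat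 g(\hat b(q))<c\big)\to0$ as $N\to\infty$; and for all sufficiently large $N$ and every $q\in[0,1)$, $$E\Big[(\hat b'(q)-b'(q))^2\,\mathbf 1\{\hat g(\hat b(q))\ge c\}\Big]^{1/2}\le C\left(\frac{b'(q)^2}{r_N}+\frac{|b''(q)|}{\sqrt{2N}}\right).$$ (2) For all sufficiently large $N$ and every $q\in[0,1)$ for which $$E\Big[\hat g(\hat b(q))^{-2}\,\mathbf 1\{\hat g(\hat b(q))<c\}\Big]^{1/2}\le \frac{L}{r_N}\qquad(\text{with }0^{-2}=\infty;\text{ this is automatic if }\hat g\ge c),$$ the mean squared error of $\hat b'(q)$ satisfies $$\mathrm{MSE}[b'(q)]=E\Big[(\hat b'(q)-b'(q))^2\Big]^{1/2}\le C\left(\frac{b'(q)^2}{r_N}+\frac{|b''(q)|}{\sqrt{2N}}\right).$$ -/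

import Mathlib

open Set Filter Topology MeasureTheory
open scoped ENNReal

noncomputable section

/-- `b'(q)`: the derivative of the bid function on the quantile interval `[0,1]`
(one-sided at the endpoints). -/
def bidDeriv (b : ℝ → ℝ) (q : ℝ) : ℝ := derivWithin b (Icc 0 1) q

/-- `b''(q)`: the second derivative of the bid function on `[0,1]`. -/
def bidDeriv2 (b : ℝ → ℝ) (q : ℝ) : ℝ := derivWithin (bidDeriv b) (Icc 0 1) q

/-- The support `b([0,1])` of the bid distribution. -/
def bidSupport (b : ℝ → ℝ) : Set ℝ := b '' Icc 0 1

/-- The c.d.f. of the bids, `G = b⁻¹`, on the support of the bid distribution. -/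
def bidCdf (b : ℝ → ℝ) : ℝ → ℝ := Function.invFunOn b (Icc 0 1)

/-- The density of the bids, `g(z) = d/dz b⁻¹(z)`, on the support of the bid distribution. -/
def bidDensity (b : ℝ → ℝ) (z : ℝ) : ℝ := derivWithin (bidCdf b) (bidSupport b) z

/-- The law of one bid: the bid `b(q)` of an agent whose quantile `q` is uniform on `[0,1]`. -/
def bidLaw (b : ℝ → ℝ) : Measure ℝ := Measure.map b (volume.restrict (Icc (0 : ℝ) 1))

/-- The law of `N` independent samples from the bid distribution. -/
def sampleLaw (b : ℝ → ℝ) (N : ℕ) : Measure (Fin N → ℝ) := Measure.pi fun _ => bidLaw b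

/-- The estimated bid function: with the sample sorted increasingly as
`s₍₁₎ ≤ ⋯ ≤ s₍N₎`, it takes the value `s₍ᵢ₎` for `q ∈ [i-1, i)/N`
(`Fin N` is zero-based, so the index is `⌊q N⌋`); the default `0` is never reached
for `q ∈ [0,1)` and `N ≥ 1`. -/
def bidEst {N : ℕ} (s : Fin N → ℝ) (q : ℝ) : ℝ :=
  if h : ⌊q * N⌋₊ < N then s (Tuple.sort s ⟨⌊q * N⌋₊, h⟩) else 0

/-- The estimator `1 / ĝ(b̂(q))` of `b'(q)`, for a density estimator `ĝ` (a function of the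
sample and of the point). -/
def bidDerivEst {N : ℕ} (ghat : (Fin N → ℝ) → ℝ → ℝ) (s : Fin N → ℝ) (q : ℝ) : ℝ :=
  1 / ghat s (bidEst s q)

/-- `E[ sup_z |ĝ(z) - g(z)|² ]^{1/2}`, the supremum over the support of the bids. -/
def densityMSE (b : ℝ → ℝ) {N : ℕ} (ghat : (Fin N → ℝ) → ℝ → ℝ) : ℝ≥0∞ :=
  (∫⁻ s, (⨆ z ∈ bidSupport b, ‖ghat s z - bidDensity b z‖ₑ ^ 2) ∂(sampleLaw b N)) ^ (1 / 2 : ℝ)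

/-- `MSE[b'(q)] = E[ (b̂'(q) - b'(q))² ]^{1/2}`. -/
def derivMSE (b : ℝ → ℝ) {N : ℕ} (ghat : (Fin N → ℝ) → ℝ → ℝ) (q : ℝ) : ℝ≥0∞ :=
  (∫⁻ s, ‖bidDerivEst ghat s q - bidDeriv b q‖ₑ ^ 2 ∂(sampleLaw b N)) ^ (1 / 2 : ℝ)

/-- The event that the estimated density at the estimated bid is below `c`. -/
def lowDensityEvent {N : ℕ} (ghat : (Fin N → ℝ) → ℝ → ℝ) (q c : ℝ) : Set (Fin N → ℝ) :=
  {s | ghat s (bidEst s q) < c}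

/-- `E[ (b̂'(q) - b'(q))² ; ĝ(b̂(q)) ≥ c ]^{1/2}`. -/
def derivMSEOff (b : ℝ → ℝ) {N : ℕ} (ghat : (Fin N → ℝ) → ℝ → ℝ) (q c : ℝ) : ℝ≥0∞ :=
  (∫⁻ s in (lowDensityEvent ghat q c)ᶜ,
    ‖bidDerivEst ghat s q - bidDeriv b q‖ₑ ^ 2 ∂(sampleLaw b N)) ^ (1 / 2 : ℝ)

/-- `E[ ĝ(b̂(q))⁻² ; ĝ(b̂(q)) < c ]^{1/2}`, with the extended value `0⁻¹ = ∞`. -/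
def recipTail (b : ℝ → ℝ) {N : ℕ} (ghat : (Fin N → ℝ) → ℝ → ℝ) (q c : ℝ) : ℝ≥0∞ :=
  (∫⁻ s in lowDensityEvent ghat q c,
    (‖ghat s (bidEst s q)‖ₑ⁻¹) ^ 2 ∂(sampleLaw b N)) ^ (1 / 2 : ℝ)

end

/-! ### Calculus of the bid function, its inverse and its density. -/

noncomputable section

variable {b : ℝ → ℝ}

/-! Let `u` be the true quantile of the estimated bid, so that the estimated bid is `b u`. Since `b'
= 1/g` along the bids, the error of `1/ĝ` splits into `1/ĝ - 1/g` at the single point `b u`, and `b'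
u - b' q`. Where `|ĝ| ≥ c`, the first part is at most `c⁻²` times the uniform error of `ĝ`, hence of
order `1/r` in mean square. The second part is at most `(|b'' q| + ε)|u - q| + M|u - q|²`
(`exists_bidDeriv_taylor_bound`).

The event that an order statistic lies below a level is an event about a sum of independent
indicators, so Hoeffding's inequality gives `P(|u - q| > t) ≤ 2 exp(-2Nt²)`; hence the second and
fourth moments of `u - q` are at most `1/N` and `1/N²`.

The constant must not depend on `b`. If eventually `r ≤ A√N`, the choice `ε = 1/A` makes `ε/√N ≤
1/r`, and `M/N ≤ ε/√N` for large `N`. Finally `1/r ≤ gbar² b'(q)²/r` because `1/b' = g ≤ gbar`. Thus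
`A` and `M` affect only how large `N` must be (`error_terms_le_sq`).

Where `|ĝ| < c`, `b' ≤ 1/c` bounds the error by `2/|ĝ|`, which the tail hypothesis controls. -/

theorem hasDerivWithinAt_bid (hb : ContDiffOn ℝ 2 b (Icc 0 1)) {q : ℝ} (hq : q ∈ Icc (0 : ℝ) 1) :
    HasDerivWithinAt b (bidDeriv b q) (Icc 0 1) q :=
  (hb.differentiableOn (by norm_num) q hq).hasDerivWithinAt

theorem contDiffOn_bidDeriv (hb : ContDiffOn ℝ 2 b (Icc 0 1)) :
    ContDiffOn ℝ 1 (bidDeriv b) (Icc 0 1) :=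
  hb.derivWithin (uniqueDiffOn_Icc zero_lt_one) (by norm_num)

theorem hasDerivWithinAt_bidDeriv (hb : ContDiffOn ℝ 2 b (Icc 0 1)) {q : ℝ}
    (hq : q ∈ Icc (0 : ℝ) 1) :
    HasDerivWithinAt (bidDeriv b) (bidDeriv2 b q) (Icc 0 1) q :=
  ((contDiffOn_bidDeriv hb).differentiableOn (by norm_num) q hq).hasDerivWithinAt

theorem continuousOn_bidDeriv2 (hb : ContDiffOn ℝ 2 b (Icc 0 1)) :
    ContinuousOn (bidDeriv2 b) (Icc 0 1) :=
  (contDiffOn_bidDeriv hb).continuousOn_derivWithin (uniqueDiffOn_Icc zero_lt_one) le_rfl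

theorem strictMonoOn_bid (hb : ContDiffOn ℝ 2 b (Icc 0 1))
    (hpos : ∀ q ∈ Icc (0 : ℝ) 1, 0 < bidDeriv b q) : StrictMonoOn b (Icc 0 1) :=
  strictMonoOn_of_hasDerivWithinAt_pos (convex_Icc 0 1) hb.continuousOn
    (fun _ hx => (hasDerivWithinAt_bid hb (interior_subset hx)).mono interior_subset)
    (fun x hx => hpos x (interior_subset hx))

theorem bidSupport_eq_Icc (hb : ContDiffOn ℝ 2 b (Icc 0 1))
    (hpos : ∀ q ∈ Icc (0 : ℝ) 1, 0 < bidDeriv b q) : bidSupport b = Icc (b 0) (b 1) := by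
  apply Subset.antisymm
  · exact (strictMonoOn_bid hb hpos).monotoneOn.image_Icc_subset
  · exact intermediate_value_Icc zero_le_one hb.continuousOn

theorem bidCdf_bid (hm : StrictMonoOn b (Icc 0 1)) {q : ℝ} (hq : q ∈ Icc (0 : ℝ) 1) :
    bidCdf b (b q) = q :=
  hm.injOn.leftInvOn_invFunOn hq

/-- The quantile of a bid, extended to a monotone function on the whole line. -/
def bidQuantile (b : ℝ → ℝ) (z : ℝ) : ℝ := bidCdf b (max (b 0) (min z (b 1)))

theorem bidQuantile_bid (hm : StrictMonoOn b (Icc 0 1)) {q : ℝ} (hq : q ∈ Icc (0 : ℝ) 1) :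
    bidQuantile b (b q) = q := by
  rw [bidQuantile, min_eq_left (hm.monotoneOn hq (by simp) hq.2),
    max_eq_right (hm.monotoneOn (by simp) hq hq.1), bidCdf_bid hm hq]

theorem max_min_mem_bidSupport (hb : ContDiffOn ℝ 2 b (Icc 0 1))
    (hpos : ∀ q ∈ Icc (0 : ℝ) 1, 0 < bidDeriv b q) (z : ℝ) :
    max (b 0) (min z (b 1)) ∈ bidSupport b := by
  have h01 : b 0 ≤ b 1 := (strictMonoOn_bid hb hpos).monotoneOn (by simp) (by simp) zero_le_one
  rw [bidSupport_eq_Icc hb hpos]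
  exact ⟨le_max_left _ _, max_le h01 (min_le_right _ _)⟩

theorem bidQuantile_mem (hb : ContDiffOn ℝ 2 b (Icc 0 1))
    (hpos : ∀ q ∈ Icc (0 : ℝ) 1, 0 < bidDeriv b q) (z : ℝ) : bidQuantile b z ∈ Icc (0 : ℝ) 1 := by
  obtain ⟨x, hx, hxz⟩ := max_min_mem_bidSupport hb hpos z
  rw [bidQuantile, ← hxz, bidCdf_bid (strictMonoOn_bid hb hpos) hx]
  exact hx

theorem monotone_bidQuantile (hb : ContDiffOn ℝ 2 b (Icc 0 1))
    (hpos : ∀ q ∈ Icc (0 : ℝ) 1, 0 < bidDeriv b q) : Monotone (bidQuantile b) := by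
  intro y z hyz
  have hm := strictMonoOn_bid hb hpos
  obtain ⟨x, hx, hxy⟩ := max_min_mem_bidSupport hb hpos y
  obtain ⟨w, hw, hwz⟩ := max_min_mem_bidSupport hb hpos z
  rw [bidQuantile, bidQuantile, ← hxy, ← hwz, bidCdf_bid hm hx, bidCdf_bid hm hw]
  refine (hm.le_iff_le hx hw).1 ?_
  rw [hxy, hwz]
  gcongr

/-- A monotone map onto `[0,1]` cannot jump. -/
theorem continuous_bidQuantile (hb : ContDiffOn ℝ 2 b (Icc 0 1))
    (hpos : ∀ q ∈ Icc (0 : ℝ) 1, 0 < bidDeriv b q) : Continuous (bidQuantile b) := by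
  have hmono : Monotone fun z => (⟨bidQuantile b z, bidQuantile_mem hb hpos z⟩ : Icc (0 : ℝ) 1) :=
    fun _ _ h => monotone_bidQuantile hb hpos h
  exact continuous_subtype_val.comp (hmono.continuous_of_surjective fun x =>
    ⟨b x, Subtype.ext (bidQuantile_bid (strictMonoOn_bid hb hpos) x.2)⟩)

/-- The density of the bids at the bid of quantile `q` is `1 / b'(q)`. -/
theorem bidDensity_bid (hb : ContDiffOn ℝ 2 b (Icc 0 1))
    (hpos : ∀ q ∈ Icc (0 : ℝ) 1, 0 < bidDeriv b q) {q : ℝ} (hq : q ∈ Icc (0 : ℝ) 1) :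
    bidDensity b (b q) = (bidDeriv b q)⁻¹ := by
  have hm := strictMonoOn_bid hb hpos
  have h01 : b 0 < b 1 := hm (by simp) (by simp) zero_lt_one
  have hmem : b q ∈ bidSupport b := mem_image_of_mem b hq
  have hu : UniqueDiffWithinAt ℝ (bidSupport b) (b q) := by
    rw [bidSupport_eq_Icc hb hpos] at hmem ⊢
    exact uniqueDiffOn_Icc h01 _ hmem
  -- The inverse function theorem is applied to `bidQuantile`, which is continuous and stays in
  -- `[0,1]` on the whole line; the c.d.f. agrees with it on the support only.
  have heq : EqOn (bidCdf b) (bidQuantile b) (bidSupport b) := by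
    rintro _ ⟨x, hx, rfl⟩
    rw [bidCdf_bid hm hx, bidQuantile_bid hm hx]
  have htend : Tendsto (bidQuantile b) (𝓝[bidSupport b] (b q))
      (𝓝[Icc 0 1] (bidQuantile b (b q))) :=
    tendsto_nhdsWithin_of_tendsto_nhds_of_eventually_within _
      ((continuous_bidQuantile hb hpos).continuousWithinAt)
      (Eventually.of_forall fun z => bidQuantile_mem hb hpos z)
  have hd : HasFDerivWithinAt b (ContinuousLinearMap.toSpanSingleton ℝ (bidDeriv b q)) (Icc 0 1)
      (bidQuantile b (b q)) := by
    rw [bidQuantile_bid hm hq]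
    exact (hasDerivWithinAt_bid hb hq).hasFDerivWithinAt
  have heqv : (ContinuousLinearEquiv.unitsEquivAut ℝ
      (Units.mk0 (bidDeriv b q) (hpos q hq).ne') : ℝ →L[ℝ] ℝ) =
      ContinuousLinearMap.toSpanSingleton ℝ (bidDeriv b q) := by
    ext
    simp
  have hinv := HasFDerivWithinAt.of_local_left_inverse htend (heqv ▸ hd) hmem (by
    refine eventually_mem_nhdsWithin.mono ?_
    rintro _ ⟨x, hx, rfl⟩
    rw [bidQuantile_bid hm hx])
  have hfin := hinv.hasDerivWithinAt.congr heq (heq hmem)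
  rw [bidDensity, hfin.derivWithin hu]
  simp

/-- The linear coefficient keeps the local value `|b'' q|`, as the theorem requires. For `|u - q| <
δ`, uniform continuity of `b''` costs only `ε`; for `|u - q| ≥ δ`, the global bound `B|u - q|` is at
most `(B/δ)|u - q|²`. So `M = B/δ` serves all `q` at once. -/
theorem exists_bidDeriv_taylor_bound (hb : ContDiffOn ℝ 2 b (Icc 0 1)) {ε : ℝ} (hε : 0 < ε) :
    ∃ M : ℝ, 0 ≤ M ∧ ∀ q ∈ Icc (0 : ℝ) 1, ∀ u ∈ Icc (0 : ℝ) 1,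
      |bidDeriv b u - bidDeriv b q| ≤ (|bidDeriv2 b q| + ε) * |u - q| + M * |u - q| ^ 2 := by
  obtain ⟨B, hB⟩ := isCompact_Icc.exists_bound_of_continuousOn (continuousOn_bidDeriv2 hb)
  have hB0 : 0 ≤ B := (norm_nonneg _).trans (hB 0 (by simp))
  have huc := isCompact_Icc.uniformContinuousOn_of_continuous (continuousOn_bidDeriv2 hb)
  obtain ⟨δ, hδ, hd⟩ := Metric.uniformContinuousOn_iff.1 huc ε hε
  refine ⟨B / δ, by positivity, fun q hq u hu => ?_⟩
  have hM : 0 ≤ B / δ * |u - q| ^ 2 := by positivity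
  rcases lt_or_ge |u - q| δ with h | h
  · have hsub : uIcc q u ⊆ Icc 0 1 := ordConnected_Icc.uIcc_subset hq hu
    have := (convex_uIcc q u).norm_image_sub_le_of_norm_hasDerivWithin_le
      (fun x hx => (hasDerivWithinAt_bidDeriv hb (hsub hx)).mono hsub)
      (C := |bidDeriv2 b q| + ε) (fun x hx => ?_) left_mem_uIcc right_mem_uIcc
    · rw [Real.norm_eq_abs, Real.norm_eq_abs] at this
      linarith
    · have h1 := hd x (hsub hx) q hq (by
        rw [Real.dist_eq]
        exact (abs_sub_left_of_mem_uIcc hx).trans_lt h)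
      rw [Real.dist_eq] at h1
      have := abs_sub_abs_le_abs_sub (bidDeriv2 b x) (bidDeriv2 b q)
      rw [Real.norm_eq_abs]
      linarith
  · have := (convex_Icc (0 : ℝ) 1).norm_image_sub_le_of_norm_hasDerivWithin_le
      (fun x hx => hasDerivWithinAt_bidDeriv hb hx) hB hq hu
    rw [Real.norm_eq_abs, Real.norm_eq_abs] at this
    have h2 : B * |u - q| ≤ B / δ * |u - q| ^ 2 := by
      rw [div_mul_eq_mul_div, le_div_iff₀ hδ]
      nlinarith [mul_nonneg hB0 (abs_nonneg (u - q))]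
    have : 0 ≤ (|bidDeriv2 b q| + ε) * |u - q| := by positivity
    linarith

/-- The density of the bids exceeds a strict lower bound by a uniform margin. -/
theorem exists_margin_bidDensity (hb : ContDiffOn ℝ 2 b (Icc 0 1))
    (hpos : ∀ q ∈ Icc (0 : ℝ) 1, 0 < bidDeriv b q) {c : ℝ}
    (hc : ∀ z ∈ bidSupport b, c < bidDensity b z) :
    ∃ η : ℝ, 0 < η ∧ ∀ z ∈ bidSupport b, c + η ≤ bidDensity b z := by
  have hcont : ContinuousOn (fun q => (bidDeriv b q)⁻¹) (Icc 0 1) :=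
    (contDiffOn_bidDeriv hb).continuousOn.inv₀ fun q hq => (hpos q hq).ne'
  obtain ⟨x, hx, hmin⟩ := isCompact_Icc.exists_isMinOn ⟨0, by simp⟩ hcont
  refine ⟨(bidDeriv b x)⁻¹ - c, ?_, ?_⟩
  · rw [← bidDensity_bid hb hpos hx]
    linarith [hc _ (mem_image_of_mem b hx)]
  · rintro _ ⟨y, hy, rfl⟩
    rw [bidDensity_bid hb hpos hy]
    have : (bidDeriv b x)⁻¹ ≤ (bidDeriv b y)⁻¹ := hmin hy
    linarith

end

/-! ### Hoeffding's inequality and moments from Gaussian tails. -/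

noncomputable section

/-- **Hoeffding's inequality** for the sum of a function with values in an interval of length one
over the coordinates of a power of a probability measure. -/
theorem pi_sum_sub_integral_ge_le {Ω : Type*} [MeasurableSpace Ω] (μ : Measure Ω)
    [IsProbabilityMeasure μ] {f : Ω → ℝ} (hf : Measurable f) {a : ℝ}
    (hfa : ∀ x, f x ∈ Icc a (a + 1)) {N : ℕ} (hN : 0 < N) {t : ℝ} (ht : 0 ≤ t) :
    (Measure.pi fun _ : Fin N => μ).real {s | N * t ≤ ∑ j, (f (s j) - ∫ x, f x ∂μ)} ≤
      Real.exp (-(2 * N) * t ^ 2) := by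
  have hind : ProbabilityTheory.iIndepFun (fun (j : Fin N) (s : Fin N → Ω) =>
      f (s j) - ∫ x, f x ∂μ) (Measure.pi fun _ : Fin N => μ) :=
    ProbabilityTheory.iIndepFun_pi (X := fun _ x => f x - ∫ x, f x ∂μ)
      fun _ => (hf.sub_const _).aemeasurable
  have hsub : ∀ j : Fin N, ProbabilityTheory.HasSubgaussianMGF
      (fun s : Fin N → Ω => f (s j) - ∫ x, f x ∂μ) ((‖a + 1 - a‖₊ / 2) ^ 2)
      (Measure.pi fun _ : Fin N => μ) := by
    intro j
    have h := ProbabilityTheory.hasSubgaussianMGF_of_mem_Icc (μ := μ) hf.aemeasurable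
      (Eventually.of_forall hfa)
    have hmp := measurePreserving_eval (fun _ : Fin N => μ) j
    rw [← hmp.map_eq] at h
    have := ProbabilityTheory.HasSubgaussianMGF.of_map hmp.measurable.aemeasurable h
    rw [hmp.map_eq] at this
    exact this
  have := ProbabilityTheory.HasSubgaussianMGF.measure_sum_ge_le_of_iIndepFun hind
    (s := Finset.univ) (fun j _ => hsub j) (ε := N * t) (by positivity)
  -- Each summand has variance proxy `1/4`, so the exponent is `-(Nt)²/(2·N/4) = -2Nt²`.
  refine this.trans (Real.exp_le_exp.2 (le_of_eq ?_))
  have hN' : (N : ℝ) ≠ 0 := by positivity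
  simp
  field_simp

/-- Moments of a nonnegative random variable with a Gaussian tail. -/
theorem lintegral_rpow_le_of_gaussian_tail {Ω : Type*} [MeasurableSpace Ω] {μ : Measure Ω}
    {X : Ω → ℝ} (hX : Measurable X) (hX0 : ∀ ω, 0 ≤ X ω) {A a : ℝ} (hA : 0 ≤ A) (ha : 0 < a)
    (htail : ∀ t, 0 < t → μ {ω | t < X ω} ≤ ENNReal.ofReal (A * Real.exp (-a * t ^ 2)))
    {p : ℝ} (hp : 0 < p) :
    ∫⁻ ω, ENNReal.ofReal (X ω ^ p) ∂μ ≤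
      ENNReal.ofReal (p * (A * (a ^ (-p / 2) * (1 / 2) * Real.Gamma (p / 2)))) := by
  -- Layer-cake formula; what remains is the Gaussian moment integral of `t^(p-1) exp(-at²)`.
  rw [lintegral_rpow_eq_lintegral_meas_lt_mul μ (Eventually.of_forall hX0) hX.aemeasurable hp,
    ENNReal.ofReal_mul hp.le]
  gcongr
  have hint : IntegrableOn (fun t : ℝ => t ^ (p - 1) * Real.exp (-a * t ^ 2)) (Ioi 0) :=
    integrableOn_rpow_mul_exp_neg_mul_sq ha (by linarith)
  have hval := integral_rpow_mul_exp_neg_mul_rpow (p := 2) (q := p - 1) zero_lt_two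
    (by linarith) ha
  simp only [Real.rpow_two, sub_add_cancel] at hval
  calc _ ≤ ∫⁻ t in Ioi (0 : ℝ),
        ENNReal.ofReal (A * (t ^ (p - 1) * Real.exp (-a * t ^ 2))) := by
        refine setLIntegral_mono' measurableSet_Ioi fun t ht => ?_
        have ht0 : (0 : ℝ) < t := ht
        calc _ ≤ ENNReal.ofReal (A * Real.exp (-a * t ^ 2)) * ENNReal.ofReal (t ^ (p - 1)) := by
              gcongr
              exact htail t ht
          _ = _ := by
              rw [← ENNReal.ofReal_mul (by positivity)]
              congr 1
              ring
    _ = ENNReal.ofReal (∫ t in Ioi (0 : ℝ), A * (t ^ (p - 1) * Real.exp (-a * t ^ 2))) := by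
        rw [ofReal_integral_eq_lintegral_ofReal (hint.const_mul A)]
        refine (ae_restrict_iff' measurableSet_Ioi).2 (Eventually.of_forall fun t ht => ?_)
        have ht0 : (0 : ℝ) < t := ht
        positivity
    _ = _ := by
        rw [integral_const_mul, hval]

/-! ### Concentration of the estimated quantile. -/

variable {b : ℝ → ℝ}

theorem aemeasurable_bid (hb : ContDiffOn ℝ 2 b (Icc 0 1)) :
    AEMeasurable b (volume.restrict (Icc (0 : ℝ) 1)) :=
  hb.continuousOn.aemeasurable measurableSet_Icc

theorem isProbabilityMeasure_bidLaw (hb : ContDiffOn ℝ 2 b (Icc 0 1)) :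
    IsProbabilityMeasure (bidLaw b) := by
  have : IsProbabilityMeasure (volume.restrict (Icc (0 : ℝ) 1)) := ⟨by simp⟩
  exact Measure.isProbabilityMeasure_map (aemeasurable_bid hb)

theorem bidLaw_real_Iic_bid (hb : ContDiffOn ℝ 2 b (Icc 0 1))
    (hpos : ∀ q ∈ Icc (0 : ℝ) 1, 0 < bidDeriv b q) {x : ℝ} (hx : x ∈ Icc (0 : ℝ) 1) :
    (bidLaw b).real (Iic (b x)) = x := by
  have hm := strictMonoOn_bid hb hpos
  have hset : b ⁻¹' Iic (b x) ∩ Icc 0 1 = Icc 0 x := by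
    ext y
    simp only [mem_inter_iff, mem_preimage, mem_Iic]
    constructor
    · rintro ⟨h, hy⟩
      exact ⟨hy.1, (hm.le_iff_le hy hx).1 h⟩
    · intro h
      have hy : y ∈ Icc (0 : ℝ) 1 := ⟨h.1, h.2.trans hx.2⟩
      exact ⟨hm.monotoneOn hy hx h.2, hy⟩
  rw [measureReal_def, bidLaw, Measure.map_apply_of_aemeasurable (aemeasurable_bid hb)
    measurableSet_Iic, Measure.restrict_apply' measurableSet_Icc, hset]
  simp [hx.1]

theorem ae_sampleLaw_mem_bidSupport (hb : ContDiffOn ℝ 2 b (Icc 0 1))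
    (hpos : ∀ q ∈ Icc (0 : ℝ) 1, 0 < bidDeriv b q) (N : ℕ) :
    ∀ᵐ s ∂(sampleLaw b N), ∀ j, s j ∈ bidSupport b := by
  have := isProbabilityMeasure_bidLaw hb
  rw [ae_all_iff]
  intro j
  have h : ∀ᵐ z ∂(bidLaw b), z ∈ bidSupport b := by
    have hms : MeasurableSet {z | z ∈ bidSupport b} := by
      rw [bidSupport_eq_Icc hb hpos]
      exact measurableSet_Icc
    rw [bidLaw, ae_map_iff (aemeasurable_bid hb) hms]
    exact (ae_restrict_iff' measurableSet_Icc).2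
      (Eventually.of_forall fun x hx => mem_image_of_mem b hx)
  exact (measurePreserving_eval (fun _ : Fin N => bidLaw b) j).quasiMeasurePreserving.ae h

theorem floor_mul_lt {q : ℝ} (hq : q ∈ Ico (0 : ℝ) 1) {N : ℕ} (hN : 0 < N) :
    ⌊q * N⌋₊ < N := by
  have hN' : (0 : ℝ) < N := by exact_mod_cast hN
  rw [Nat.floor_lt (mul_nonneg hq.1 hN'.le)]
  nlinarith [hq.2]

theorem bidEst_mem {q : ℝ} (hq : q ∈ Ico (0 : ℝ) 1) {N : ℕ} (hN : 0 < N) {s : Fin N → ℝ}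
    {S : Set ℝ} (hs : ∀ j, s j ∈ S) : bidEst s q ∈ S := by
  rw [bidEst, dif_pos (floor_mul_lt hq hN)]
  exact hs _

/-- The order statistic of zero-based index `k` is at most `y` exactly when at least `k + 1` sample
points are; the strict inequality carries this off-by-one. It turns an order statistic into a sum of
independent indicators. -/
theorem bidEst_le_iff {q : ℝ} (hq : q ∈ Ico (0 : ℝ) 1) {N : ℕ} (hN : 0 < N) (s : Fin N → ℝ)
    (y : ℝ) : bidEst s q ≤ y ↔
      (⌊q * N⌋₊ : ℝ) < ∑ j, (Iic y).indicator (fun _ => (1 : ℝ)) (s j) := by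
  have hcard : ∑ j, (Iic y).indicator (fun _ => (1 : ℝ)) (s j) =
      ((Finset.univ.filter fun i => (s ∘ Tuple.sort s) i ≤ y).card : ℝ) := by
    rw [← Equiv.sum_comp (Tuple.sort s), Finset.card_filter]
    push_cast
    exact Finset.sum_congr rfl fun j _ => by simp [indicator_apply]
  rw [bidEst, dif_pos (floor_mul_lt hq hN), hcard, Nat.cast_lt]
  exact (Tuple.lt_card_le_iff_apply_le_of_monotone (j := ⟨⌊q * N⌋₊, floor_mul_lt hq hN⟩) (a := y)
    (Tuple.monotone_sort s)).symm

theorem measurable_bidEst {q : ℝ} (hq : q ∈ Ico (0 : ℝ) 1) {N : ℕ} (hN : 0 < N) :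
    Measurable fun s : Fin N → ℝ => bidEst s q := by
  refine measurable_of_Iic fun y => ?_
  have : (fun s : Fin N → ℝ => bidEst s q) ⁻¹' Iic y =
      {s | (⌊q * N⌋₊ : ℝ) < ∑ j, (Iic y).indicator (fun _ => (1 : ℝ)) (s j)} := by
    ext s
    exact bidEst_le_iff hq hN s y
  rw [this]
  refine measurableSet_lt measurable_const (Finset.measurable_fun_sum _ fun j _ => ?_)
  exact (measurable_const.indicator measurableSet_Iic).comp (measurable_pi_apply j)

/-- The quantile of the estimated bid has Gaussian tails around its target. -/
theorem sampleLaw_lt_abs_bidQuantile_sub_le (hb : ContDiffOn ℝ 2 b (Icc 0 1))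
    (hpos : ∀ q ∈ Icc (0 : ℝ) 1, 0 < bidDeriv b q) {q : ℝ} (hq : q ∈ Ico (0 : ℝ) 1) {N : ℕ}
    (hN : 0 < N) {t : ℝ} (ht : 0 < t) :
    sampleLaw b N {s | t < |bidQuantile b (bidEst s q) - q|} ≤
      ENNReal.ofReal (2 * Real.exp (-(2 * N) * t ^ 2)) := by
  have := isProbabilityMeasure_bidLaw hb
  have hprob : IsProbabilityMeasure (sampleLaw b N) := by unfold sampleLaw; infer_instance
  have hm := strictMonoOn_bid hb hpos
  have hmono := monotone_bidQuantile hb hpos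
  have hN' : (0 : ℝ) < N := by exact_mod_cast hN
  have hind : ∀ y, Measurable ((Iic y).indicator (fun _ : ℝ => (1 : ℝ))) := fun y =>
    measurable_const.indicator measurableSet_Iic
  have hint : ∀ x ∈ Icc (0 : ℝ) 1,
      ∫ z, (Iic (b x)).indicator (fun _ : ℝ => (1 : ℝ)) z ∂(bidLaw b) = x := fun x hx => by
    rw [integral_indicator_const _ measurableSet_Iic, bidLaw_real_Iic_bid hb hpos hx]
    simp
  have hup : (sampleLaw b N).real {s | t < bidQuantile b (bidEst s q) - q} ≤
      Real.exp (-(2 * N) * t ^ 2) := by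
    -- If `q + t > 1` the event is empty, as quantiles do not exceed `1`. Otherwise at most `⌊qN⌋ ≤
    -- qN` bids are `≤ b (q + t)`, while `N(q + t)` are expected: a deficit of `Nt`, seen as an
    -- upper deviation of the negated indicators.
    by_cases hx : q + t ≤ 1
    · have hxm : q + t ∈ Icc (0 : ℝ) 1 := ⟨by linarith [hq.1], hx⟩
      refine le_trans (measureReal_mono ?_) (pi_sum_sub_integral_ge_le (bidLaw b)
        (f := fun z => -(Iic (b (q + t))).indicator (fun _ : ℝ => (1 : ℝ)) z) (hind _).neg
        (a := -1) (fun z => by by_cases h : z ∈ Iic (b (q + t)) <;> simp [h]) hN ht.le)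
      intro s hs
      have h1 : ¬ bidEst s q ≤ b (q + t) := fun h => by
        have := hmono h
        rw [bidQuantile_bid hm hxm] at this
        have : t < bidQuantile b (bidEst s q) - q := hs
        linarith
      rw [bidEst_le_iff hq hN, not_lt] at h1
      have h2 := Nat.floor_le (mul_nonneg hq.1 hN'.le)
      simp only [mem_ofPred_eq, integral_neg, hint _ hxm, Finset.sum_sub_distrib,
        Finset.sum_neg_distrib, Finset.sum_const, Finset.card_univ, Fintype.card_fin, nsmul_eq_mul]
      nlinarith
    · have : {s : Fin N → ℝ | t < bidQuantile b (bidEst s q) - q} = ∅ := by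
        refine eq_empty_of_forall_notMem fun s hs => hx ?_
        have h1 : t < bidQuantile b (bidEst s q) - q := hs
        linarith [(bidQuantile_mem hb hpos (bidEst s q)).2]
      rw [this, measureReal_empty]
      positivity
  have hdown : (sampleLaw b N).real {s | t < q - bidQuantile b (bidEst s q)} ≤
      Real.exp (-(2 * N) * t ^ 2) := by
    by_cases hx : 0 ≤ q - t
    · have hxm : q - t ∈ Icc (0 : ℝ) 1 := ⟨hx, by linarith [hq.2]⟩
      refine le_trans (measureReal_mono ?_) (pi_sum_sub_integral_ge_le (bidLaw b)
        (f := (Iic (b (q - t))).indicator (fun _ : ℝ => (1 : ℝ))) (hind _)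
        (a := 0) (fun z => by by_cases h : z ∈ Iic (b (q - t)) <;> simp [h]) hN ht.le)
      intro s hs
      have h1 : bidEst s q ≤ b (q - t) := by
        by_contra! h
        have := hmono h.le
        rw [bidQuantile_bid hm hxm] at this
        have : t < q - bidQuantile b (bidEst s q) := hs
        linarith
      rw [bidEst_le_iff hq hN] at h1
      have h2 := Nat.lt_floor_add_one (q * N)
      -- The count is an integer, so exceeding `⌊qN⌋` means reaching `⌊qN⌋ + 1 > qN`. Rounding
      -- therefore costs nothing, and the surplus over `N(q - t)` is at least `Nt`.
      have h3 : (⌊q * N⌋₊ : ℝ) + 1 ≤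
          ∑ j, (Iic (b (q - t))).indicator (fun _ => (1 : ℝ)) (s j) := by
        have hcard : ∑ j, (Iic (b (q - t))).indicator (fun _ => (1 : ℝ)) (s j) =
            ((Finset.univ.filter fun i => s i ≤ b (q - t)).card : ℝ) := by
          rw [Finset.card_filter]
          push_cast
          exact Finset.sum_congr rfl fun j _ => by simp [indicator_apply]
        rw [hcard] at h1 ⊢
        exact_mod_cast h1
      simp only [mem_ofPred_eq, hint _ hxm, Finset.sum_sub_distrib,
        Finset.sum_const, Finset.card_univ, Fintype.card_fin, nsmul_eq_mul]
      nlinarith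
    · have : {s : Fin N → ℝ | t < q - bidQuantile b (bidEst s q)} = ∅ := by
        refine eq_empty_of_forall_notMem fun s hs => hx ?_
        have h1 : t < q - bidQuantile b (bidEst s q) := hs
        linarith [(bidQuantile_mem hb hpos (bidEst s q)).1]
      rw [this, measureReal_empty]
      positivity
  rw [← ofReal_measureReal]
  refine ENNReal.ofReal_le_ofReal ?_
  have hsub : {s : Fin N → ℝ | t < |bidQuantile b (bidEst s q) - q|} ⊆
      {s | t < bidQuantile b (bidEst s q) - q} ∪ {s | t < q - bidQuantile b (bidEst s q)} := by
    intro s hs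
    rcases lt_abs.1 (show t < |bidQuantile b (bidEst s q) - q| from hs) with h | h
    · exact Or.inl h
    · exact Or.inr (by simpa using h)
  calc _ ≤ _ := measureReal_mono hsub
    _ ≤ _ := measureReal_union_le _ _
    _ ≤ _ := by linarith

theorem measurable_abs_bidQuantile_sub (hb : ContDiffOn ℝ 2 b (Icc 0 1))
    (hpos : ∀ q ∈ Icc (0 : ℝ) 1, 0 < bidDeriv b q) {q : ℝ} (hq : q ∈ Ico (0 : ℝ) 1) {N : ℕ}
    (hN : 0 < N) :
    Measurable fun s : Fin N → ℝ => |bidQuantile b (bidEst s q) - q| :=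
  (((monotone_bidQuantile hb hpos).measurable.comp (measurable_bidEst hq hN)).sub_const q).abs

theorem lintegral_bidQuantile_sub_sq_le (hb : ContDiffOn ℝ 2 b (Icc 0 1))
    (hpos : ∀ q ∈ Icc (0 : ℝ) 1, 0 < bidDeriv b q) {q : ℝ} (hq : q ∈ Ico (0 : ℝ) 1) {N : ℕ}
    (hN : 0 < N) :
    ∫⁻ s, ENNReal.ofReal (|bidQuantile b (bidEst s q) - q| ^ 2) ∂(sampleLaw b N) ≤
      ENNReal.ofReal (1 / N) := by
  have hN' : (0 : ℝ) < N := by exact_mod_cast hN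
  have h := lintegral_rpow_le_of_gaussian_tail (measurable_abs_bidQuantile_sub hb hpos hq hN)
    (fun _ => abs_nonneg _) zero_le_two (by positivity : (0 : ℝ) < 2 * N)
    (fun t ht => sampleLaw_lt_abs_bidQuantile_sub_le hb hpos hq hN ht) (zero_lt_two)
  simp only [Real.rpow_two] at h
  refine h.trans (ENNReal.ofReal_le_ofReal (le_of_eq ?_))
  rw [show (-2 / 2 : ℝ) = -1 by norm_num, div_self two_ne_zero, Real.Gamma_one, Real.rpow_neg_one]
  field_simp

theorem lintegral_bidQuantile_sub_pow_four_le (hb : ContDiffOn ℝ 2 b (Icc 0 1))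
    (hpos : ∀ q ∈ Icc (0 : ℝ) 1, 0 < bidDeriv b q) {q : ℝ} (hq : q ∈ Ico (0 : ℝ) 1) {N : ℕ}
    (hN : 0 < N) :
    ∫⁻ s, ENNReal.ofReal (|bidQuantile b (bidEst s q) - q| ^ 4) ∂(sampleLaw b N) ≤
      ENNReal.ofReal (1 / N ^ 2) := by
  have hN' : (0 : ℝ) < N := by exact_mod_cast hN
  have h := lintegral_rpow_le_of_gaussian_tail (measurable_abs_bidQuantile_sub hb hpos hq hN)
    (fun _ => abs_nonneg _) zero_le_two (by positivity : (0 : ℝ) < 2 * N)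
    (fun t ht => sampleLaw_lt_abs_bidQuantile_sub_le hb hpos hq hN ht) (zero_lt_four)
  have h4 : ∀ x : ℝ, x ^ (4 : ℝ) = x ^ 4 := fun x => by exact_mod_cast Real.rpow_natCast x 4
  simp only [h4] at h
  refine h.trans (ENNReal.ofReal_le_ofReal (le_of_eq ?_))
  rw [show (-4 / 2 : ℝ) = -2 by norm_num, show (4 / 2 : ℝ) = 2 by norm_num, Real.Gamma_two,
    Real.rpow_neg (by positivity), Real.rpow_two]
  field_simp
  norm_num

end

/-! ### Pointwise error decomposition and its integral. -/

noncomputable section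

theorem Real.enorm_sq_eq_ofReal (x : ℝ) : ‖x‖ₑ ^ 2 = ENNReal.ofReal (x ^ 2) := by
  rw [Real.enorm_eq_ofReal_abs, ← ENNReal.ofReal_pow (abs_nonneg x), sq_abs]

theorem ENNReal.rpow_half_le_iff {x y : ℝ≥0∞} : x ^ (1 / 2 : ℝ) ≤ y ↔ x ≤ y ^ 2 := by
  rw [one_div, ENNReal.rpow_inv_le_iff two_pos, ENNReal.rpow_two]

/-- No sign is required because `K` and `L` are arbitrary reals. -/
theorem ENNReal.ofReal_sq_le (x : ℝ) : ENNReal.ofReal x ^ 2 ≤ ENNReal.ofReal (x ^ 2) := by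
  rcases le_total 0 x with h | h
  · rw [ENNReal.ofReal_pow h]
  · simp [ENNReal.ofReal_of_nonpos h]

variable {b : ℝ → ℝ}

/-- Pointwise error of a reciprocal density estimate `γ`, bounded away from zero, taken at the bid
of quantile `u` instead of `q`. -/
theorem sq_one_div_sub_bidDeriv_le (hb : ContDiffOn ℝ 2 b (Icc 0 1))
    (hpos : ∀ q ∈ Icc (0 : ℝ) 1, 0 < bidDeriv b q) {c : ℝ} (hc : 0 < c)
    (hcg : ∀ z ∈ bidSupport b, c < bidDensity b z) {ε M q u γ : ℝ}
    (hu : u ∈ Icc (0 : ℝ) 1) (hγ : c ≤ |γ|)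
    (hT : |bidDeriv b u - bidDeriv b q| ≤ (|bidDeriv2 b q| + ε) * |u - q| + M * |u - q| ^ 2) :
    (1 / γ - bidDeriv b q) ^ 2 ≤ 3 * ((1 / c ^ 2) ^ 2 * (γ - bidDensity b (b u)) ^ 2 +
      (|bidDeriv2 b q| + ε) ^ 2 * |u - q| ^ 2 + M ^ 2 * |u - q| ^ 4) := by
  have hg := hcg _ (mem_image_of_mem b hu)
  have hgu := bidDensity_bid hb hpos hu
  set g := bidDensity b (b u)
  have hg0 : 0 < g := hc.trans hg
  have hγ0 : γ ≠ 0 := abs_pos.1 (hc.trans_le hγ)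
  have hbu : bidDeriv b u = 1 / g := by rw [hgu, one_div, inv_inv]
  have h1 : |1 / γ - bidDeriv b u| ≤ 1 / c ^ 2 * |γ - g| := by
    rw [hbu, div_sub_div _ _ hγ0 hg0.ne', abs_div, abs_mul, abs_of_pos hg0, one_mul, mul_one,
      abs_sub_comm, one_div_mul_eq_div]
    gcongr
    nlinarith
  -- Triangle inequality through `b' u = 1/g(b u)`.
  have h2 : |1 / γ - bidDeriv b q| ≤ 1 / c ^ 2 * |γ - g| +
      (|bidDeriv2 b q| + ε) * |u - q| + M * |u - q| ^ 2 := by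
    have := abs_sub_le (1 / γ) (bidDeriv b u) (bidDeriv b q)
    linarith
  have h3 : ∀ x y z : ℝ, (x + y + z) ^ 2 ≤ 3 * (x ^ 2 + y ^ 2 + z ^ 2) := fun x y z => by
    nlinarith [sq_nonneg (x - y), sq_nonneg (y - z), sq_nonneg (x - z)]
  calc _ = |1 / γ - bidDeriv b q| ^ 2 := (sq_abs _).symm
    _ ≤ _ := pow_le_pow_left₀ (abs_nonneg _) h2 2
    _ ≤ _ := h3 _ _ _
    _ = _ := by rw [mul_pow, sq_abs]; ring

/-- A random bound for the squared error of the estimated derivative at the sample `s`: the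
squared uniform error of the density estimate, and two moments of the quantile error. -/
def derivErrorBound (b : ℝ → ℝ) {N : ℕ} (ghat : (Fin N → ℝ) → ℝ → ℝ) (q A B M : ℝ)
    (s : Fin N → ℝ) : ℝ≥0∞ :=
  3 * (ENNReal.ofReal A * (⨆ z ∈ bidSupport b, ‖ghat s z - bidDensity b z‖ₑ ^ 2) +
    ENNReal.ofReal B * ENNReal.ofReal (|bidQuantile b (bidEst s q) - q| ^ 2) +
    ENNReal.ofReal M * ENNReal.ofReal (|bidQuantile b (bidEst s q) - q| ^ 4))

theorem lintegral_derivErrorBound_le (hb : ContDiffOn ℝ 2 b (Icc 0 1))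
    (hpos : ∀ q ∈ Icc (0 : ℝ) 1, 0 < bidDeriv b q) {q : ℝ} (hq : q ∈ Ico (0 : ℝ) 1) {N : ℕ}
    (hN : 0 < N) (ghat : (Fin N → ℝ) → ℝ → ℝ) {A B M κ : ℝ} (hA : 0 ≤ A) (hB : 0 ≤ B)
    (hM : 0 ≤ M) (hκ : 0 ≤ κ) (hmse : densityMSE b ghat ^ 2 ≤ ENNReal.ofReal κ) :
    ∫⁻ s, derivErrorBound b ghat q A B M s ∂(sampleLaw b N) ≤
      ENNReal.ofReal (3 * (A * κ + B * (1 / N) + M * (1 / N ^ 2))) := by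
  have hmeas := measurable_abs_bidQuantile_sub hb hpos hq hN
  have hsup := ENNReal.rpow_half_le_iff.1 (le_refl (densityMSE b ghat))
  unfold derivErrorBound
  -- The supremum over the uncountable support need not be measurable; additivity here asks
  -- measurability only of the right summands, which are the quantile terms.
  rw [lintegral_const_mul' _ _ (by simp), lintegral_add_right _ (by fun_prop),
    lintegral_add_right _ (by fun_prop), lintegral_const_mul' _ _ ENNReal.ofReal_ne_top,
    lintegral_const_mul' _ _ ENNReal.ofReal_ne_top,
    lintegral_const_mul' _ _ ENNReal.ofReal_ne_top, ENNReal.ofReal_mul (by norm_num),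
    ENNReal.ofReal_add (by positivity) (by positivity),
    ENNReal.ofReal_add (by positivity) (by positivity), ENNReal.ofReal_mul hA,
    ENNReal.ofReal_mul hB, ENNReal.ofReal_mul hM]
  gcongr
  · simp
  · exact hsup.trans hmse
  · exact lintegral_bidQuantile_sub_sq_le hb hpos hq hN
  · exact lintegral_bidQuantile_sub_pow_four_le hb hpos hq hN

/-- Assuming only `c ≤ |ĝ|` also covers estimates `≤ -c`, which belong to the low-density event but
cause no blow-up of the reciprocal. -/
theorem enorm_sq_le_derivErrorBound (hb : ContDiffOn ℝ 2 b (Icc 0 1))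
    (hpos : ∀ q ∈ Icc (0 : ℝ) 1, 0 < bidDeriv b q) {c : ℝ} (hc : 0 < c)
    (hcg : ∀ z ∈ bidSupport b, c < bidDensity b z) {ε M : ℝ}
    (hT : ∀ q ∈ Icc (0 : ℝ) 1, ∀ u ∈ Icc (0 : ℝ) 1,
      |bidDeriv b u - bidDeriv b q| ≤ (|bidDeriv2 b q| + ε) * |u - q| + M * |u - q| ^ 2)
    {q : ℝ} (hq : q ∈ Ico (0 : ℝ) 1) {N : ℕ} (hN : 0 < N) (ghat : (Fin N → ℝ) → ℝ → ℝ)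
    {s : Fin N → ℝ} (hs : ∀ j, s j ∈ bidSupport b) (hγ : c ≤ |ghat s (bidEst s q)|) :
    ‖bidDerivEst ghat s q - bidDeriv b q‖ₑ ^ 2 ≤
      derivErrorBound b ghat q ((1 / c ^ 2) ^ 2) ((|bidDeriv2 b q| + ε) ^ 2) (M ^ 2) s := by
  have hz : bidEst s q ∈ bidSupport b := bidEst_mem hq hN hs
  have hsup : ENNReal.ofReal ((ghat s (bidEst s q) - bidDensity b (bidEst s q)) ^ 2) ≤
      ⨆ z ∈ bidSupport b, ‖ghat s z - bidDensity b z‖ₑ ^ 2 := by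
    rw [← Real.enorm_sq_eq_ofReal]
    exact le_biSup (fun z => ‖ghat s z - bidDensity b z‖ₑ ^ 2) hz
  obtain ⟨u, hu, hbu⟩ := hz
  have h := sq_one_div_sub_bidDeriv_le hb hpos hc hcg hu hγ (hT q ⟨hq.1, hq.2.le⟩ u hu)
  rw [Real.enorm_sq_eq_ofReal]
  refine (ENNReal.ofReal_le_ofReal h).trans ?_
  rw [ENNReal.ofReal_mul (by norm_num),
    ENNReal.ofReal_add (by positivity) (by positivity),
    ENNReal.ofReal_add (by positivity) (by positivity), ENNReal.ofReal_mul (by positivity),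
    ENNReal.ofReal_mul (by positivity), ENNReal.ofReal_mul (by positivity), derivErrorBound,
    ← hbu, bidQuantile_bid (strictMonoOn_bid hb hpos) hu, hbu]
  gcongr
  simp

/-! ### The low-density event and the two mean squared errors. -/

theorem measurableSet_lowDensityEvent {N : ℕ} {ghat : (Fin N → ℝ) → ℝ → ℝ}
    (hg : Measurable (Function.uncurry ghat)) {q : ℝ} (hq : q ∈ Ico (0 : ℝ) 1) (hN : 0 < N)
    (c : ℝ) : MeasurableSet (lowDensityEvent ghat q c) :=
  measurableSet_lt (hg.comp (measurable_id.prodMk (measurable_bidEst hq hN))) measurable_const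

/-- Chebyshev's argument: on the event `ĝ < c` while `g ≥ c + η` at the same bid, so the squared
uniform error is at least `η²`. -/
theorem sampleLaw_lowDensityEvent_le (hb : ContDiffOn ℝ 2 b (Icc 0 1))
    (hpos : ∀ q ∈ Icc (0 : ℝ) 1, 0 < bidDeriv b q) {c η : ℝ} (hη : 0 < η)
    (hcg : ∀ z ∈ bidSupport b, c + η ≤ bidDensity b z) {N : ℕ} {ghat : (Fin N → ℝ) → ℝ → ℝ}
    (hg : Measurable (Function.uncurry ghat)) {q : ℝ} (hq : q ∈ Ico (0 : ℝ) 1) (hN : 0 < N) :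
    ENNReal.ofReal (η ^ 2) * sampleLaw b N (lowDensityEvent ghat q c) ≤ densityMSE b ghat ^ 2 := by
  have hms := measurableSet_lowDensityEvent hg hq hN c
  refine le_trans ?_ (ENNReal.rpow_half_le_iff.1 (le_refl (densityMSE b ghat)))
  rw [← lintegral_indicator_const hms]
  refine lintegral_mono_ae ?_
  filter_upwards [ae_sampleLaw_mem_bidSupport hb hpos N] with s hs
  refine indicator_apply_le' (fun h => ?_) (fun _ => zero_le)
  have hz : bidEst s q ∈ bidSupport b := bidEst_mem hq hN hs
  refine le_trans ?_ (le_biSup (fun z => ‖ghat s z - bidDensity b z‖ₑ ^ 2) hz)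
  rw [Real.enorm_sq_eq_ofReal]
  refine ENNReal.ofReal_le_ofReal ?_
  have h1 : ghat s (bidEst s q) < c := h
  have h2 := hcg _ hz
  nlinarith

theorem derivMSEOff_le (hb : ContDiffOn ℝ 2 b (Icc 0 1))
    (hpos : ∀ q ∈ Icc (0 : ℝ) 1, 0 < bidDeriv b q) {c : ℝ} (hc : 0 < c)
    (hcg : ∀ z ∈ bidSupport b, c < bidDensity b z) {ε M : ℝ}
    (hT : ∀ q ∈ Icc (0 : ℝ) 1, ∀ u ∈ Icc (0 : ℝ) 1,
      |bidDeriv b u - bidDeriv b q| ≤ (|bidDeriv2 b q| + ε) * |u - q| + M * |u - q| ^ 2)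
    {N : ℕ} {ghat : (Fin N → ℝ) → ℝ → ℝ} (hg : Measurable (Function.uncurry ghat))
    {q : ℝ} (hq : q ∈ Ico (0 : ℝ) 1) (hN : 0 < N) :
    derivMSEOff b ghat q c ≤ (∫⁻ s, derivErrorBound b ghat q ((1 / c ^ 2) ^ 2)
      ((|bidDeriv2 b q| + ε) ^ 2) (M ^ 2) s ∂(sampleLaw b N)) ^ (1 / 2 : ℝ) := by
  refine ENNReal.rpow_le_rpow ?_ (by norm_num)
  refine le_trans (lintegral_mono_ae ?_) (setLIntegral_le_lintegral _ _)
  rw [ae_restrict_iff' (measurableSet_lowDensityEvent hg hq hN c).compl]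
  filter_upwards [ae_sampleLaw_mem_bidSupport hb hpos N] with s hs hlow
  exact enorm_sq_le_derivErrorBound hb hpos hc hcg hT hq hN ghat hs
    (le_trans (not_lt.1 hlow) (le_abs_self _))

/-- Both `1/|γ|` and `d ≤ 1/c` are at most `1/|γ|`. At `γ = 0` the right side is infinite, so the
convention `1/0 = 0` on the left is harmless. -/
theorem enorm_one_div_sub_sq_le {c γ d : ℝ} (hd0 : 0 ≤ d) (hd : d ≤ 1 / c) (hγ : |γ| < c) :
    ‖1 / γ - d‖ₑ ^ 2 ≤ 4 * (‖γ‖ₑ⁻¹) ^ 2 := by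
  rcases eq_or_ne γ 0 with rfl | h0
  · simp
  have hpos := abs_pos.2 h0
  have h1 : |1 / γ - d| ≤ 2 * |γ|⁻¹ := by
    have h2 : 1 / c ≤ |γ|⁻¹ := by
      rw [← one_div]
      exact one_div_le_one_div_of_le hpos hγ.le
    calc |1 / γ - d| ≤ |1 / γ| + |d| := abs_sub _ _
      _ = |γ|⁻¹ + d := by rw [abs_div, abs_one, one_div, abs_of_nonneg hd0]
      _ ≤ _ := by linarith
  calc ‖1 / γ - d‖ₑ ^ 2 ≤ (2 * ‖γ‖ₑ⁻¹) ^ 2 := by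
        gcongr
        rw [Real.enorm_eq_ofReal_abs, Real.enorm_eq_ofReal_abs, ← ENNReal.ofReal_inv_of_pos hpos,
          show (2 : ℝ≥0∞) = ENNReal.ofReal 2 by simp, ← ENNReal.ofReal_mul zero_le_two]
        exact ENNReal.ofReal_le_ofReal h1
    _ = _ := by rw [mul_pow]; norm_num

theorem derivMSE_le (hb : ContDiffOn ℝ 2 b (Icc 0 1))
    (hpos : ∀ q ∈ Icc (0 : ℝ) 1, 0 < bidDeriv b q) {c : ℝ} (hc : 0 < c)
    (hcg : ∀ z ∈ bidSupport b, c < bidDensity b z) {ε M : ℝ}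
    (hT : ∀ q ∈ Icc (0 : ℝ) 1, ∀ u ∈ Icc (0 : ℝ) 1,
      |bidDeriv b u - bidDeriv b q| ≤ (|bidDeriv2 b q| + ε) * |u - q| + M * |u - q| ^ 2)
    {N : ℕ} {ghat : (Fin N → ℝ) → ℝ → ℝ} (hg : Measurable (Function.uncurry ghat))
    {q : ℝ} (hq : q ∈ Ico (0 : ℝ) 1) (hN : 0 < N) :
    derivMSE b ghat q ≤ (∫⁻ s, derivErrorBound b ghat q ((1 / c ^ 2) ^ 2)
      ((|bidDeriv2 b q| + ε) ^ 2) (M ^ 2) s ∂(sampleLaw b N) +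
        4 * recipTail b ghat q c ^ 2) ^ (1 / 2 : ℝ) := by
  refine ENNReal.rpow_le_rpow ?_ (by norm_num)
  have hms := measurableSet_lowDensityEvent hg hq hN c
  have hq' : q ∈ Icc (0 : ℝ) 1 := ⟨hq.1, hq.2.le⟩
  have hmeas : Measurable fun s : Fin N → ℝ => ghat s (bidEst s q) :=
    hg.comp (measurable_id.prodMk (measurable_bidEst hq hN))
  have hsq : Measurable fun s : Fin N → ℝ => (‖ghat s (bidEst s q)‖ₑ⁻¹) ^ 2 :=
    hmeas.enorm.inv.pow_const 2
  have hd : bidDeriv b q ≤ 1 / c := by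
    have h := hcg _ (mem_image_of_mem b hq')
    rw [bidDensity_bid hb hpos hq'] at h
    rw [← inv_inv (bidDeriv b q), ← one_div]
    exact one_div_le_one_div_of_le hc h.le
  have htail : ∫⁻ s in lowDensityEvent ghat q c, (‖ghat s (bidEst s q)‖ₑ⁻¹) ^ 2 ∂(sampleLaw b N) ≤
      recipTail b ghat q c ^ 2 := ENNReal.rpow_half_le_iff.1 le_rfl
  calc _ ≤ ∫⁻ s, (derivErrorBound b ghat q ((1 / c ^ 2) ^ 2)
        ((|bidDeriv2 b q| + ε) ^ 2) (M ^ 2) s + (lowDensityEvent ghat q c).indicator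
          (fun s => 4 * (‖ghat s (bidEst s q)‖ₑ⁻¹) ^ 2) s) ∂(sampleLaw b N) := by
        refine lintegral_mono_ae ?_
        filter_upwards [ae_sampleLaw_mem_bidSupport hb hpos N] with s hs
        -- The split is by `|ĝ|`, not `ĝ`; the case `|ĝ| < c` lies inside the low-density event.
        rcases le_or_gt c |ghat s (bidEst s q)| with h | h
        · exact (enorm_sq_le_derivErrorBound hb hpos hc hcg hT hq hN ghat hs h).trans le_self_add
        · have hlow : s ∈ lowDensityEvent ghat q c := (le_abs_self _).trans_lt h
          rw [indicator_of_mem hlow]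
          exact (enorm_one_div_sub_sq_le (hpos q hq').le hd h).trans le_add_self
    _ ≤ _ := by
        rw [lintegral_add_right _
          ((hsq.const_mul 4).indicator hms), lintegral_indicator hms,
          lintegral_const_mul' _ _ (by simp)]
        gcongr

/-- Here `D = b'(q)²`, `β = |b''(q)|`, `n = N`. The hypotheses on `ε` and `M` push the remainder
terms into multiples of `1/r²`, and `hDg` converts `1/r` into `gbar² D/r`, so neither `ε` nor `M`
enters the constant. -/
theorem error_terms_le_sq {A K gbar L D β ε M n r : ℝ} (hr : 0 < r) (hn : 0 < n) (hD : 0 ≤ D)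
    (hβ : 0 ≤ β) (hε : 0 < ε) (hDg : 1 ≤ gbar ^ 2 * D) (hεr : r * ε ≤ √n)
    (hMn : M ^ 2 ≤ ε ^ 2 * n) :
    3 * (A * (K / r) ^ 2 + (β + ε) ^ 2 * (1 / n) + M ^ 2 * (1 / n ^ 2)) + 4 * (L / r) ^ 2 ≤
      ((5 + gbar ^ 2 * (4 * L ^ 2 + 3 * |A| * K ^ 2 + 12)) * (D / r + β / √(2 * n))) ^ 2 := by
  obtain ⟨ρ, hρ⟩ : ∃ ρ, ρ = 1 / r := ⟨_, rfl⟩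
  obtain ⟨m, hm⟩ : ∃ m, m = 1 / √(2 * n) := ⟨_, rfl⟩
  have hρ0 : 0 < ρ := by rw [hρ]; positivity
  have hm0 : 0 < m := by rw [hm]; positivity
  have hm2 : 1 / n = 2 * m ^ 2 := by
    rw [hm, div_pow, Real.sq_sqrt (by positivity)]
    field_simp
  have hεm : ε ^ 2 * (1 / n) ≤ ρ ^ 2 := by
    have h : (r * ε) ^ 2 ≤ n := by
      calc (r * ε) ^ 2 ≤ √n ^ 2 := pow_le_pow_left₀ (by positivity) hεr 2
        _ = n := Real.sq_sqrt hn.le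
    rw [hρ, div_pow, one_pow, mul_one_div, div_le_div_iff₀ hn (by positivity)]
    nlinarith
  have hM : M ^ 2 * (1 / n ^ 2) ≤ ε ^ 2 * (1 / n) := by
    calc M ^ 2 * (1 / n ^ 2) ≤ ε ^ 2 * n * (1 / n ^ 2) := by gcongr
      _ = _ := by field_simp
  have hβε : (β + ε) ^ 2 * (1 / n) ≤ 4 * (β * m) ^ 2 + 2 * ρ ^ 2 := by
    have h1 : (β + ε) ^ 2 ≤ 2 * β ^ 2 + 2 * ε ^ 2 := by nlinarith [sq_nonneg (β - ε)]
    calc (β + ε) ^ 2 * (1 / n) ≤ (2 * β ^ 2 + 2 * ε ^ 2) * (1 / n) := by gcongr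
      _ = 2 * β ^ 2 * (2 * m ^ 2) + 2 * (ε ^ 2 * (1 / n)) := by rw [← hm2]; ring
      _ = 4 * (β * m) ^ 2 + 2 * (ε ^ 2 * (1 / n)) := by ring
      _ ≤ _ := by gcongr
  -- `W` collects the coefficients of `ρ²`: the remainders contribute `3·(2 + 1) = 9 ≤ 12`, and the
  -- slack gives `W ≥ 1`, hence `Wρ² ≤ (Wρ)²`. The coefficient `12` of `(βm)²` is absorbed by `5² =
  -- 25`.
  set W := 4 * L ^ 2 + 3 * |A| * K ^ 2 + 12 with hW
  have hW1 : 1 ≤ W := by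
    have : 0 ≤ 4 * L ^ 2 + 3 * |A| * K ^ 2 := by positivity
    linarith
  have hAK : A * (K / r) ^ 2 ≤ |A| * K ^ 2 * ρ ^ 2 := by
    rw [hρ, div_pow, div_pow, one_pow, mul_assoc, mul_one_div]
    gcongr
    exact le_abs_self A
  have hL : (L / r) ^ 2 = L ^ 2 * ρ ^ 2 := by rw [hρ]; ring
  have hleft : 3 * (A * (K / r) ^ 2 + (β + ε) ^ 2 * (1 / n) + M ^ 2 * (1 / n ^ 2)) +
      4 * (L / r) ^ 2 ≤ W * ρ ^ 2 + 12 * (β * m) ^ 2 := by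
    have h1 : W * ρ ^ 2 = 4 * (L ^ 2 * ρ ^ 2) + 3 * (|A| * K ^ 2 * ρ ^ 2) + 12 * ρ ^ 2 := by
      rw [hW]
      ring
    rw [hL, h1]
    linarith [sq_nonneg ρ]
  refine hleft.trans ?_
  rw [show D / r = D * ρ by rw [hρ]; ring, show β / √(2 * n) = β * m by rw [hm]; ring]
  have hx : W * ρ ≤ gbar ^ 2 * W * (D * ρ) := by
    calc W * ρ = 1 * (W * ρ) := (one_mul _).symm
      _ ≤ gbar ^ 2 * D * (W * ρ) := by gcongr
      _ = _ := by ring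
  have hDρ : 0 ≤ D * ρ := by positivity
  have hβm : 0 ≤ β * m := by positivity
  have hgW : 0 ≤ gbar ^ 2 * W := by positivity
  have hsum : W * ρ + 5 * (β * m) ≤ (5 + gbar ^ 2 * W) * (D * ρ + β * m) := by
    have h1 : (5 + gbar ^ 2 * W) * (D * ρ + β * m) = gbar ^ 2 * W * (D * ρ) + 5 * (β * m) +
        5 * (D * ρ) + gbar ^ 2 * W * (β * m) := by ring
    rw [h1]
    linarith [mul_nonneg hgW hβm]
  have hWρ : 0 ≤ W * ρ := by positivity
  calc W * ρ ^ 2 + 12 * (β * m) ^ 2 ≤ (W * ρ + 5 * (β * m)) ^ 2 := by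
        have : W * ρ ^ 2 ≤ (W * ρ) ^ 2 := by
          rw [mul_pow]
          gcongr
          exact le_self_pow₀ hW1 two_ne_zero
        have h2 : (W * ρ + 5 * (β * m)) ^ 2 =
            (W * ρ) ^ 2 + 10 * (W * ρ * (β * m)) + 25 * (β * m) ^ 2 := by ring
        linarith [mul_nonneg hWρ hβm, sq_nonneg (β * m)]
    _ ≤ _ := pow_le_pow_left₀ (by positivity) hsum 2

end
-- Choice of the constant and of the threshold for `N`.
theorem mainTheorem9 (K c gbar L : ℝ) (hc : 0 < c) :
    ∃ C : ℝ, 0 < C ∧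
      ∀ (b : ℝ → ℝ) (r : ℕ → ℝ) (ghat : (N : ℕ) → (Fin N → ℝ) → ℝ → ℝ),
        -- the bid function is twice continuously differentiable with a positive derivative
        ContDiffOn ℝ 2 b (Icc 0 1) →
        (∀ q ∈ Icc (0 : ℝ) 1, 0 < bidDeriv b q) →
        -- the density of bids is bounded by `gbar`, and `c` lies below it
        (∀ z ∈ bidSupport b, bidDensity b z ≤ gbar) →
        (∀ z ∈ bidSupport b, c < bidDensity b z) →
        -- `ghat` estimates the density at the rate `r`
        (∀ N, Measurable (Function.uncurry (ghat N))) →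
        Tendsto r atTop atTop →
        (r =O[atTop] fun N : ℕ => √(N : ℝ)) →
        (∀ᶠ N in atTop, densityMSE b (ghat N) ≤ ENNReal.ofReal (K / r N)) →
        -- the event `ghat (bidEst s q) < c` has vanishing probability, uniformly in `q`
        (∀ ε : ℝ, 0 < ε → ∀ᶠ N in atTop, ∀ q ∈ Ico (0 : ℝ) 1,
          sampleLaw b N (lowDensityEvent (ghat N) q c) ≤ ENNReal.ofReal ε) ∧
        ∀ᶠ N : ℕ in atTop, ∀ q ∈ Ico (0 : ℝ) 1,
          derivMSEOff b (ghat N) q c ≤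
            ENNReal.ofReal
              (C * (bidDeriv b q ^ 2 / r N + |bidDeriv2 b q| / √(2 * (N : ℝ)))) ∧
          (recipTail b (ghat N) q c ≤ ENNReal.ofReal (L / r N) →
            derivMSE b (ghat N) q ≤
              ENNReal.ofReal
                (C * (bidDeriv b q ^ 2 / r N + |bidDeriv2 b q| / √(2 * (N : ℝ))))) := by
  refine ⟨5 + gbar ^ 2 * (4 * L ^ 2 + 3 * |(1 / c ^ 2) ^ 2| * K ^ 2 + 12), by positivity, ?_⟩
  intro b r ghat hb hpos hgbar hcg hmeas hr hO hrate
  have hrate2 : ∀ᶠ N in atTop, densityMSE b (ghat N) ^ 2 ≤ ENNReal.ofReal ((K / r N) ^ 2) :=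
    hrate.mono fun N h => (pow_le_pow_left' h 2).trans (ENNReal.ofReal_sq_le _)
  constructor
  · intro ε hε
    obtain ⟨η, hη, hmargin⟩ := exists_margin_bidDensity hb hpos hcg
    have hlim : Tendsto (fun N => (K / r N) ^ 2) atTop (𝓝 0) := by
      simpa using (hr.const_div_atTop K).pow 2
    have hsmall := hlim.eventually_lt_const (by positivity : 0 < η ^ 2 * ε)
    filter_upwards [hrate2, hsmall, eventually_gt_atTop 0] with N h1 h2 hN q hq
    have h := (sampleLaw_lowDensityEvent_le hb hpos hη hmargin (hmeas N) hq hN).trans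
      (h1.trans (ENNReal.ofReal_le_ofReal h2.le))
    rw [ENNReal.ofReal_mul (by positivity)] at h
    exact (ENNReal.mul_le_mul_iff_right (by simp; positivity) ENNReal.ofReal_ne_top).1 h
  · obtain ⟨A, hA, hbound⟩ := hO.exists_pos
    -- With `r ≤ A√N` eventually, `ε = 1/A` is what makes `rε ≤ √N`. `M` depends on `b`, but only
    -- through the threshold `hMN`.
    obtain ⟨M, hM0, hT⟩ := exists_bidDeriv_taylor_bound hb (ε := 1 / A) (by positivity)
    have hMN : ∀ᶠ N : ℕ in atTop, M ^ 2 ≤ (1 / A) ^ 2 * N :=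
      (tendsto_natCast_atTop_atTop.const_mul_atTop (by positivity)).eventually_ge_atTop _
    filter_upwards [hrate2, hbound.bound, hMN, hr.eventually_gt_atTop 0, eventually_gt_atTop 0]
      with N h1 h2 h3 hr0 hN q hq
    have hq' : q ∈ Icc (0 : ℝ) 1 := ⟨hq.1, hq.2.le⟩
    have hN' : (0 : ℝ) < N := by exact_mod_cast hN
    have hDg : 1 ≤ gbar ^ 2 * bidDeriv b q ^ 2 := by
      have h := hgbar _ (mem_image_of_mem b hq')
      have hd := hpos q hq'
      rw [bidDensity_bid hb hpos hq', inv_le_iff_one_le_mul₀ hd] at h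
      rw [← mul_pow]
      exact one_le_pow₀ h
    have hεr : r N * (1 / A) ≤ √(N : ℝ) := by
      rw [Real.norm_of_nonneg hr0.le, Real.norm_of_nonneg (Real.sqrt_nonneg _)] at h2
      rw [mul_one_div, div_le_iff₀ hA]
      linarith
    have hint := lintegral_derivErrorBound_le hb hpos hq hN (ghat N)
      (A := (1 / c ^ 2) ^ 2) (B := (|bidDeriv2 b q| + 1 / A) ^ 2) (M := M ^ 2)
      (by positivity) (by positivity) (by positivity) (sq_nonneg _) h1
    have hreal := error_terms_le_sq (A := (1 / c ^ 2) ^ 2) (K := K) (L := L) hr0 hN'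
      (sq_nonneg (bidDeriv b q)) (abs_nonneg (bidDeriv2 b q)) (by positivity : 0 < 1 / A)
      hDg hεr h3
    have hC0 : 0 ≤ (5 + gbar ^ 2 * (4 * L ^ 2 + 3 * |(1 / c ^ 2) ^ 2| * K ^ 2 + 12)) *
        (bidDeriv b q ^ 2 / r N + |bidDeriv2 b q| / √(2 * (N : ℝ))) := by positivity
    constructor
    · refine (derivMSEOff_le hb hpos hc hcg hT (hmeas N) hq hN).trans ?_
      rw [ENNReal.rpow_half_le_iff, ← ENNReal.ofReal_pow hC0]
      refine hint.trans (ENNReal.ofReal_le_ofReal (le_trans ?_ hreal))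
      -- Off the low-density event the `L` term is not needed and is simply added.
      exact le_add_of_nonneg_right (by positivity)
    · intro htail
      refine (derivMSE_le hb hpos hc hcg hT (hmeas N) hq hN).trans ?_
      rw [ENNReal.rpow_half_le_iff, ← ENNReal.ofReal_pow hC0]
      refine le_trans ?_ (ENNReal.ofReal_le_ofReal hreal)
      rw [ENNReal.ofReal_add (by positivity) (by positivity),
        ENNReal.ofReal_mul (p := 4) (by norm_num)]
      gcongr
      · simp
      · exact (pow_le_pow_left' htail 2).trans (ENNReal.ofReal_sq_le _)
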